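/- Let $p$ be a fixed prime and define $c_p$ by $p^{1-c_p}=\inf_{0<x<1}x^{-(p-1)/3}\left(1+x+\cdots+x^{p-1}\right)$; put $C_p=1+1/c_p$. A triangle in $\mathbb{F}_p^n$ is an ordered triple $(x,y,z)$ of points of $\mathbb{F}_p^n$ with $x+y+z=0$. For $n\ge 0$ let $N=p^n$, let $m=\epsilon N$ with $\epsilon>0$, and let $\{(x_i,y_i,z_i)\}_{i=1}^m$ be $m$ disjoint triangles in $\mathbb{F}_p^n$. (It is enough that the $x_i$ are distinct, the $y_i$ are distinct and the $z_i$ are distinct.) Put $X=\{x_i\}_{i=1}^m$, $Y=\{y_i\}_{i=1}^m$, $Z=\{z_i\}_{i=1}^m$. Then $X\times Y\times Z$ contains at least $\epsilon^{C_p+o(1)}N^2$ triangles, where the $o(1)$ term is a function of $p$ and $\epsilon$ only (not of $n$ or of the triangles) that tends to $0$ as $\epsilon\to0$ with $p$ fixed. More explicitly, there is a constant $K_p>0$ depending only on $p$ such that, whenever $0<\epsilon\le 1/2$, the number of triangles in $X\times Y\times Z$ is at least \[K_p\,\epsilon^{1+1/c_p}\left(\log_2(1/\epsilon)\right)^{-(2+2c_p)/c_p}N^2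 .\] -/

import Mathlib

noncomputable section

/-- The function `x ↦ x ^ (-(p-1)/3) * (1 + x + ⋯ + x ^ (p-1))`. -/
def triangleWeight (p : ℕ) (x : ℝ) : ℝ :=
  x ^ (-((p : ℝ) - 1) / 3) * ∑ i ∈ Finset.range p, x ^ i

/-- The constant `c_p`, given by
`p ^ (1 - c_p) = inf_{0 < x < 1} x ^ (-(p-1)/3) * (1 + x + ⋯ + x ^ (p-1))`. -/
def smallC (p : ℕ) : ℝ :=
  1 - Real.logb p (sInf (triangleWeight p '' Set.Ioo 0 1))

/-- The exponent `C_p = 1 + 1 / c_p`. -/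
def bigC (p : ℕ) : ℝ := 1 + 1 / smallC p

end

/-- `(x i, y i, z i)`, for `i < m`, is a family of `m` disjoint triangles in `F_p^n`: each triple
sums to zero, and no point is used twice as a first coordinate, twice as a second coordinate, or
twice as a third coordinate. (This holds in particular whenever the point sets
`{x i, y i, z i}` are pairwise disjoint.) -/
structure IsDisjointTriangleFamily {p n m : ℕ} (x y z : Fin m → Fin n → ZMod p) : Prop where
  sum_eq_zero : ∀ i, x i + y i + z i = 0
  injective_fst : Function.Injective x
  injective_snd : Function.Injective y
  injective_trd : Function.Injective z

/-- The number of triangles in `X × Y × Z`: ordered triples `(a, b, c)` with `a + b + c = 0`. -/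
def triangleCount {p n : ℕ} (X Y Z : Finset (Fin n → ZMod p)) : ℕ :=
  ((X ×ˢ Y ×ˢ Z).filter fun t => t.1 + t.2.1 + t.2.2 = 0).card

/-!
The slice rank method bounds a tricolored sum-free set in `F_p^d` by `3 D ^ (1 - c)`, where
`D = p ^ d` and `c = c_p` (`card_le_of_tricolored_rpow`): the tensor `1_{u + v + w = 0}` is a
combination of monomials of degree at most `(p - 1) d` in `(u, v, w)`, each of degree at most
`(p - 1) d / 3` in one of the three variables, and the number of such monomials in one variable is
at most `(x ^ (-(p - 1) / 3) (1 + ⋯ + x ^ (p - 1))) ^ d` for every `0 < x < 1`.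

To use it, suppose that `X × Y × Z` has `τ` triangles and that every vertex lies in at most `Δ` of
them. Pull `X`, `Y`, `Z` back along random maps `u ↦ A u + a`, `v ↦ A v + b`, `w ↦ A w - a - b` from
`F_p^d` with `D ≈ N / (6 Δ)`. About `D ^ 2 τ / N ^ 2` triangles are expected to survive, and at
least half of them share no vertex with another survivor, so they form a tricolored sum-free set. Hence
`D ^ 2 τ ≤ 6 N ^ 2 D ^ (1 - c)` (`sq_mul_card_trianglePairs_le`).

This is strong when `τ` is close to `Δ ε N`. That is arranged by deleting vertices of high degree
(`exists_nearly_regular`): at stage `j` the degrees are at most `N / 2 ^ j`, and either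
`τ ≥ N 2 ^ (-j) ε N w_j / 6` with `w_j = 1 / ((j + 1) (j + 2))`, or halving the degree bound costs
at most a proportion `w_j` of the matching. As `∑ w_j = 1` and the partial sums stay below `1`, some
matching triangle always remains, so the process must stop. At the final stage the sum-free bound
gives `2 ^ (j c) ε w_j = O(1)`; therefore `j = O(log (2 / ε))`, and
`τ ≥ N ^ 2 ε w_j 2 ^ (-j) / 6` is at least a constant times
`ε ^ (1 + 1 / c) log (2 / ε) ^ (-2 (1 + 1 / c)) N ^ 2`.
-/

open Finset Filter Topology

/-! ### Tricolored sum-free sets -/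

/-- A subspace of `S → K` contains a vector whose support is at least as large as its dimension:
restriction of the subspace to the support of a vector of maximal support is injective. -/
theorem exists_mem_finrank_le_card_support {K S : Type*} [Field K] [DecidableEq K] [Fintype S]
    (H : Submodule K (S → K)) :
    ∃ h ∈ H, Module.finrank K H ≤ #{s | h s ≠ 0} := by
  classical
  have hne : ∃ h : H, ∀ g : H, #{s | (g : S → K) s ≠ 0} ≤ #{s | (h : S → K) s ≠ 0} := by
    have hb : BddAbove (Set.range fun g : H => #{s | (g : S → K) s ≠ 0}) :=
      ⟨Fintype.card S, by rintro _ ⟨g, rfl⟩; exact card_le_univ _⟩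
    obtain ⟨h, hh⟩ := Nat.sSup_mem (Set.range_nonempty _) hb
    exact ⟨h, fun g => by
      have := le_csSup hb ⟨g, rfl⟩
      rw [← hh] at this; exact this⟩
  obtain ⟨⟨h, hH⟩, hmax⟩ := hne
  refine ⟨h, hH, ?_⟩
  let P : Finset S := {s | h s ≠ 0}
  let r : H →ₗ[K] (P → K) := (LinearMap.funLeft K K (Subtype.val : P → S)).comp H.subtype
  have hr : Function.Injective r := by
    rw [← LinearMap.ker_eq_bot, LinearMap.ker_eq_bot']
    rintro ⟨g, hg⟩ hg0
    have hz : ∀ s, h s ≠ 0 → g s = 0 := fun s hs =>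
      congrFun hg0 (⟨s, by simp [P, hs]⟩ : P)
    by_contra hne
    obtain ⟨s, hs⟩ : ∃ s, g s ≠ 0 := by
      by_contra! hall
      exact hne (Subtype.ext (funext hall))
    have h0 : h s = 0 := by
      by_contra h'
      exact hs (hz s h')
    have hlt := hmax ⟨h + g, H.add_mem hH hg⟩
    refine absurd hlt (not_le.mpr (card_lt_card ?_))
    rw [ssubset_iff_of_subset]
    · exact ⟨s, by simp [h0, hs], by simp [h0]⟩
    · intro t ht
      simp only [mem_filter, mem_univ, true_and] at ht ⊢
      simpa [hz t ht] using ht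
  calc Module.finrank K H ≤ Module.finrank K (P → K) :=
        LinearMap.finrank_le_finrank_of_injective hr
    _ = #P := by rw [Module.finrank_fintype_fun_eq_card, Fintype.card_coe]

/-- The linear-algebra form of the bound on the slice rank of a diagonal tensor. Contracting the
tensor with `h ⊥ A` and `k ⊥ B` kills the first two kinds of slices and leaves `h * k` in the span of
`C`. Choosing `h` of support at least `|S| - |M|`, the admissible `k` supported on that of `h` form a
space of dimension at least `|S| - 2 |M|`, on which multiplication by `h` is injective. -/
theorem card_le_three_mul_of_mul_mem_span {K S M : Type*} [Field K] [Fintype S]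
    [Fintype M] (A B C : M → S → K)
    (hABC : ∀ h k : S → K, (∀ α, ∑ s, h s * A α s = 0) → (∀ β, ∑ s, k s * B β s = 0) →
      h * k ∈ Submodule.span K (Set.range C)) :
    Fintype.card S ≤ 3 * Fintype.card M := by
  classical
  let φ : (S → K) →ₗ[K] (M → K) :=
    LinearMap.pi fun α => ∑ s, (A α s) • LinearMap.proj s
  have hφ : ∀ h ∈ LinearMap.ker φ, ∀ α, ∑ s, h s * A α s = 0 := fun h hh α => by
    have := congrFun (LinearMap.mem_ker.mp hh) α
    simpa [φ, mul_comm] using this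
  obtain ⟨h, hH, hcard⟩ := exists_mem_finrank_le_card_support (LinearMap.ker φ)
  have h1 := LinearMap.finrank_range_add_finrank_ker φ
  have h2 : Module.finrank K (LinearMap.range φ) ≤ Fintype.card M :=
    (Submodule.finrank_le _).trans (by simp)
  let Q : Finset S := {s | h s = 0}
  let ψ : (S → K) →ₗ[K] (M → K) × (Q → K) :=
    (LinearMap.pi fun β => ∑ s, (B β s) • LinearMap.proj s).prod
      (LinearMap.funLeft K K (Subtype.val : Q → S))
  have hψ1 : ∀ k ∈ LinearMap.ker ψ, ∀ β, ∑ s, k s * B β s = 0 := fun k hk β => by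
    have := congrFun (congrArg Prod.fst (LinearMap.mem_ker.mp hk)) β
    simpa [ψ, mul_comm] using this
  have hψ2 : ∀ k ∈ LinearMap.ker ψ, ∀ s, h s = 0 → k s = 0 := fun k hk s hs =>
    congrFun (congrArg Prod.snd (LinearMap.mem_ker.mp hk)) (⟨s, by simp [Q, hs]⟩ : Q)
  have h3 := LinearMap.finrank_range_add_finrank_ker ψ
  have h4 : Module.finrank K (LinearMap.range ψ) ≤ Fintype.card M + #Q :=
    (Submodule.finrank_le _).trans (by simp)
  let ρ : LinearMap.ker ψ →ₗ[K] Submodule.span K (Set.range C) :=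
    ((LinearMap.mulLeft K h).comp (LinearMap.ker ψ).subtype).codRestrict _
      fun k => hABC h k (hφ h hH) (hψ1 k k.2)
  have hρ : Function.Injective ρ := by
    rw [← LinearMap.ker_eq_bot, LinearMap.ker_eq_bot']
    rintro ⟨k, hk⟩ hk0
    have hz : h * k = 0 := congrArg Subtype.val hk0
    refine Subtype.ext (funext fun s => ?_)
    rcases mul_eq_zero.mp (congrFun hz s) with h0 | h0
    · exact hψ2 k hk s h0
    · exact h0
  have h5 := LinearMap.finrank_le_finrank_of_injective hρ
  have h6 : Module.finrank K (Submodule.span K (Set.range C)) ≤ Fintype.card M :=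
    finrank_range_le_card C
  have h7 : #Q + #{s | h s ≠ 0} = Fintype.card S :=
    card_filter_add_card_filter_not (s := univ) (fun s => h s = 0)
  rw [Module.finrank_fintype_fun_eq_card] at h1 h3
  omega

/-- Exponent vectors `α : {1, …, d} → {0, …, p - 1}` of total degree at most `(p - 1) d / 3`. -/
def lowMonomials (p d : ℕ) : Finset (Fin d → ℕ) :=
  {α ∈ Fintype.piFinset fun _ => range p | 3 * ∑ l, α l ≤ (p - 1) * d}

theorem card_lowMonomials_le {p d : ℕ} (hp : 1 ≤ p) {x : ℝ} (hx : x ∈ Set.Ioo (0 : ℝ) 1) :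
    (#(lowMonomials p d) : ℝ) ≤ triangleWeight p x ^ d := by
  have hx0 := hx.1
  have key : triangleWeight p x ^ d = ∑ α ∈ Fintype.piFinset fun _ : Fin d => range p,
      ∏ l, x ^ ((α l : ℝ) - ((p : ℝ) - 1) / 3) := by
    rw [← prod_univ_sum (fun _ : Fin d => range p)
      (fun _ i => x ^ ((i : ℝ) - ((p : ℝ) - 1) / 3)), prod_const, card_univ, Fintype.card_fin]
    congr 1
    rw [triangleWeight, mul_sum]
    refine sum_congr rfl fun i _ => ?_
    rw [sub_eq_neg_add (i : ℝ), Real.rpow_add hx0, Real.rpow_natCast, neg_div]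
  rw [key, card_eq_sum_ones, Nat.cast_sum]
  refine (sum_le_sum fun α hα => ?_).trans (sum_le_sum_of_subset_of_nonneg
    (filter_subset _ _) fun α _ _ => prod_nonneg fun l _ => (Real.rpow_pos_of_pos hx0 _).le)
  rw [← Real.rpow_sum_of_pos hx0, Nat.cast_one]
  refine Real.one_le_rpow_of_pos_of_le_one_of_nonpos hx0 hx.2.le ?_
  have h3 : ((3 * ∑ l, α l : ℕ) : ℝ) ≤ (((p - 1) * d : ℕ) : ℝ) := by
    exact_mod_cast (mem_filter.mp hα).2
  push_cast [Nat.cast_sub hp] at h3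
  rw [sum_sub_distrib, sum_const, card_univ, Fintype.card_fin, nsmul_eq_mul]
  linarith

/-- The indicator of `a + b + c = 0` on `F_p`, as a polynomial of degree at most `p - 1`. -/
theorem exists_indicator_expansion (p : ℕ) [Fact p.Prime] :
    ∃ c : ℕ × ℕ × ℕ → ZMod p, ∀ a b e : ZMod p,
      (if a + b + e = 0 then 1 else 0) =
        ∑ i ∈ ((range p ×ˢ range p ×ˢ range p).filter fun i => i.1 + i.2.1 + i.2.2 ≤ p - 1),
          c i * (a ^ i.1 * b ^ i.2.1 * e ^ i.2.2) := by
  have hp := (Fact.out : p.Prime).two_le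
  let E := (range p ×ˢ range p ×ˢ range p).filter fun i : ℕ × ℕ × ℕ => i.1 + i.2.1 + i.2.2 ≤ p - 1
  -- By Fermat, the indicator is `1 - (a + b + e) ^ (p - 1)`.
  have hpow : ∃ c : ℕ × ℕ × ℕ → ZMod p, ∀ a b e : ZMod p, (a + b + e) ^ (p - 1) =
      ∑ i ∈ E, c i * (a ^ i.1 * b ^ i.2.1 * e ^ i.2.2) := by
    refine ⟨fun i => if i.1 + i.2.1 + i.2.2 = p - 1 then
      ((p - 1).choose (i.1 + i.2.1) * (i.1 + i.2.1).choose i.1 : ℕ) else 0, fun a b e => ?_⟩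
    rw [add_pow]
    simp_rw [add_pow, sum_mul]
    rw [sum_sigma']
    symm
    simp_rw [ite_mul, zero_mul]
    rw [← sum_filter]
    refine sum_bij' (fun i _ => ⟨i.1 + i.2.1, i.1⟩) (fun j _ => (j.2, j.1 - j.2, p - 1 - j.1))
      ?_ ?_ ?_ ?_ ?_
    · rintro ⟨i, j, k⟩ h
      simp only [E, mem_filter, mem_product, mem_range, mem_sigma] at h ⊢
      omega
    · rintro ⟨i, j⟩ h
      simp only [E, mem_filter, mem_product, mem_range, mem_sigma] at h ⊢
      omega
    · rintro ⟨i, j, k⟩ h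
      simp only [E, mem_filter, mem_product, mem_range] at h
      have h1 : p - 1 - (i + j) = k := by omega
      have h2 : i + j - i = j := by omega
      simp only [h1, h2]
    · rintro ⟨i, j⟩ h
      simp only [mem_range, mem_sigma] at h
      have : j + (i - j) = i := by omega
      simp [this]
    · rintro ⟨i, j, k⟩ h
      simp only [E, mem_filter, mem_product, mem_range] at h
      have h1 : p - 1 - (i + j) = k := by omega
      have h2 : i + j - i = j := by omega
      simp only [h1, h2]
      push_cast
      ring
  obtain ⟨c, hc⟩ := hpow
  refine ⟨fun i => (if i = (0, 0, 0) then 1 else 0) - c i, fun a b e => ?_⟩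
  have h0 : ((0, 0, 0) : ℕ × ℕ × ℕ) ∈ E := by
    simp only [E, mem_filter, mem_product, mem_range]; omega
  simp_rw [sub_mul, sum_sub_distrib, ite_mul, zero_mul]
  rw [sum_ite_eq' , if_pos h0, ← hc a b e]
  split_ifs with h
  · rw [h, zero_pow (by omega)]; simp
  · rw [ZMod.pow_card_sub_one_eq_one h]; simp

/-- The tensor on triples of `S` given by a tricolored sum-free family is diagonal, and each
monomial in its expansion has low degree in one of the three variables. -/
theorem card_le_of_tricolored {p d : ℕ} [Fact p.Prime] {S : Type*} [Fintype S]
    (u v w : S → Fin d → ZMod p)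
    (h : ∀ s t r, u s + v t + w r = 0 ↔ s = t ∧ t = r) :
    Fintype.card S ≤ 3 * #(lowMonomials p d) := by
  classical
  obtain ⟨c, hc⟩ := exists_indicator_expansion p
  set E := (range p ×ˢ range p ×ˢ range p).filter fun i : ℕ × ℕ × ℕ =>
    i.1 + i.2.1 + i.2.2 ≤ p - 1 with hE
  let mon (y : S → Fin d → ZMod p) (α : Fin d → ℕ) (s : S) : ZMod p := ∏ l, y s l ^ α l
  have hexp : ∀ s t r, (if s = t ∧ t = r then (1 : ZMod p) else 0) =
      ∑ e ∈ Fintype.piFinset fun _ : Fin d => E, (∏ l, c (e l)) *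
        (mon u (fun l => (e l).1) s * mon v (fun l => (e l).2.1) t *
          mon w (fun l => (e l).2.2) r) := by
    intro s t r
    have : (if s = t ∧ t = r then (1 : ZMod p) else 0) =
        ∏ l, if u s l + v t l + w r l = 0 then 1 else 0 := by
      rw [Finset.prod_ite_zero]
      simp only [← h, funext_iff, Pi.add_apply, Pi.zero_apply, mem_univ, true_imp_iff,
        prod_const_one]
    rw [this]
    simp_rw [hc]
    rw [prod_univ_sum]
    refine sum_congr rfl fun e _ => ?_
    simp only [mon, prod_mul_distrib]
  have hlow : ∀ e ∈ Fintype.piFinset fun _ : Fin d => E,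
      (fun l => (e l).1) ∈ lowMonomials p d ∨ (fun l => (e l).2.1) ∈ lowMonomials p d ∨
        (fun l => (e l).2.2) ∈ lowMonomials p d := by
    intro e he
    have he' : ∀ l, e l ∈ E := Fintype.mem_piFinset.mp he
    simp only [hE, mem_filter, mem_product, mem_range] at he'
    have hs : ∑ l, ((e l).1 + (e l).2.1 + (e l).2.2) ≤ ∑ _l : Fin d, (p - 1) :=
      sum_le_sum fun l _ => (he' l).2
    simp only [sum_add_distrib, sum_const, card_univ, Fintype.card_fin, smul_eq_mul] at hs
    simp only [lowMonomials, mem_filter, Fintype.mem_piFinset, mem_range]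
    have h1 := fun l => (he' l).1.1
    have h2 := fun l => (he' l).1.2.1
    have h3 := fun l => (he' l).1.2.2
    simp only [h1, h2, h3, implies_true, true_and]
    rw [mul_comm d] at hs
    omega
  rw [← Fintype.card_coe (lowMonomials p d)]
  refine card_le_three_mul_of_mul_mem_span (K := ZMod p) (fun α : lowMonomials p d => mon u α)
    (fun α => mon v α) (fun α => mon w α) fun f g hf hg => ?_
  -- Contract the diagonal tensor with `f` and `g`: only monomials of low degree in `w` survive.
  have hfg : f * g = ∑ e ∈ Fintype.piFinset fun _ : Fin d => E,
      ((∏ l, c (e l)) * (∑ s, f s * mon u (fun l => (e l).1) s) *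
        (∑ t, g t * mon v (fun l => (e l).2.1) t)) • mon w (fun l => (e l).2.2) := by
    ext r
    have : (f * g) r = ∑ s, ∑ t, f s * g t * (if s = t ∧ t = r then (1 : ZMod p) else 0) := by
      rw [sum_eq_single r, sum_eq_single r]
      · simp
      · intro t _ ht; simp [ht]
      · simp
      · intro s _ hs
        refine sum_eq_zero fun t _ => ?_
        rw [if_neg (fun h' => hs (h'.1.trans h'.2)), mul_zero]
      · simp
    rw [this]
    simp_rw [hexp, mul_sum]
    rw [Finset.sum_apply]
    simp_rw [sum_comm (t := Fintype.piFinset fun _ : Fin d => E)]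
    refine sum_congr rfl fun e _ => ?_
    simp only [Pi.smul_apply, smul_eq_mul, sum_mul]
    rw [sum_comm]
    refine sum_congr rfl fun t _ => sum_congr rfl fun s _ => ?_
    ring
  rw [hfg]
  refine Submodule.sum_mem _ fun e he => ?_
  rcases hlow e he with h1 | h1 | h1
  · have := hf ⟨_, h1⟩
    simp only at this
    simp [this]
  · have := hg ⟨_, h1⟩
    simp only at this
    simp [this]
  · exact Submodule.smul_mem _ _ (Submodule.subset_span ⟨⟨_, h1⟩, rfl⟩)

theorem one_le_triangleWeight {p : ℕ} (hp : 1 ≤ p) {x : ℝ} (hx : x ∈ Set.Ioo (0 : ℝ) 1) :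
    1 ≤ triangleWeight p x := by
  refine one_le_mul_of_one_le_of_one_le ?_ ?_
  · refine Real.one_le_rpow_of_pos_of_le_one_of_nonpos hx.1 hx.2.le ?_
    have : (1 : ℝ) ≤ p := by exact_mod_cast hp
    linarith
  · calc (1 : ℝ) = x ^ 0 := (pow_zero x).symm
      _ ≤ _ := single_le_sum (f := fun i => x ^ i) (fun i _ => pow_nonneg hx.1.le i)
        (mem_range.mpr hp)

theorem one_le_sInf_triangleWeight {p : ℕ} (hp : 1 ≤ p) :
    1 ≤ sInf (triangleWeight p '' Set.Ioo 0 1) := by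
  refine le_csInf ⟨_, 1 / 2, by norm_num, rfl⟩ ?_
  rintro _ ⟨x, hx, rfl⟩
  exact one_le_triangleWeight hp hx

/-- The derivative of the weight at `1` is `p (p - 1) / 6 > 0`, so the weight drops below its
value `p` at `1` just to the left of `1`. -/
theorem sInf_triangleWeight_lt {p : ℕ} (hp : 2 ≤ p) :
    sInf (triangleWeight p '' Set.Ioo 0 1) < p := by
  have hp' : (2 : ℝ) ≤ p := by exact_mod_cast hp
  have hd : HasDerivAt (triangleWeight p) ((p : ℝ) * (p - 1) / 6) 1 := by
    have h1 : HasDerivAt (fun x : ℝ => x ^ (-((p : ℝ) - 1) / 3)) (-((p : ℝ) - 1) / 3) 1 := by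
      simpa using Real.hasDerivAt_rpow_const (x := 1) (p := -((p : ℝ) - 1) / 3) (Or.inl one_ne_zero)
    have h2 : HasDerivAt (fun x : ℝ => ∑ i ∈ range p, x ^ i) (∑ i ∈ range p, (i : ℝ)) 1 := by
      refine HasDerivAt.fun_sum fun i _ => ?_
      simpa using hasDerivAt_pow i (1 : ℝ)
    have h3 : ∑ i ∈ range p, (i : ℝ) = p * (p - 1) / 2 := by
      have := Finset.sum_range_id_mul_two p
      have h4 : ((∑ i ∈ range p, i : ℕ) : ℝ) * 2 = p * ((p - 1 : ℕ) : ℝ) := by exact_mod_cast this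
      rw [Nat.cast_sub (by omega)] at h4
      push_cast at h4
      linarith
    have h4 := h1.mul h2
    rw [h3] at h4
    refine h4.congr_deriv ?_
    simp
    ring
  have hpos : 0 < (p : ℝ) * (p - 1) / 6 := by
    have : 0 < (p : ℝ) - 1 := by linarith
    positivity
  have h1 : triangleWeight p 1 = p := by simp [triangleWeight]
  have hslope := (hasDerivAt_iff_tendsto_slope_left_right.mp hd).1.eventually (lt_mem_nhds hpos)
  obtain ⟨x, hx, hx'⟩ := (hslope.and (Ioo_mem_nhdsLT (zero_lt_one' ℝ))).exists
  rw [slope_def_field, h1] at hx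
  have hlt : triangleWeight p x < p := by
    have h2 : x - 1 < 0 := by linarith [hx'.2]
    have := (div_pos_iff.mp hx).resolve_left (fun h => by linarith [h.2])
    linarith [this.1]
  have hbdd : BddBelow (triangleWeight p '' Set.Ioo 0 1) := by
    refine ⟨1, ?_⟩
    rintro _ ⟨x, hx, rfl⟩
    exact one_le_triangleWeight (by omega) hx
  exact (csInf_le hbdd (Set.mem_image_of_mem _ hx')).trans_lt hlt

theorem smallC_pos {p : ℕ} (hp : 2 ≤ p) : 0 < smallC p := by
  have hp' : (1 : ℝ) < p := by exact_mod_cast hp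
  rw [smallC, sub_pos, Real.logb_lt_iff_lt_rpow hp'
    (one_pos.trans_le (one_le_sInf_triangleWeight (by omega))), Real.rpow_one]
  exact sInf_triangleWeight_lt hp

theorem smallC_le_one {p : ℕ} (hp : 2 ≤ p) : smallC p ≤ 1 := by
  have hp' : (1 : ℝ) < p := by exact_mod_cast hp
  have := Real.logb_nonneg hp' (one_le_sInf_triangleWeight (p := p) (by omega))
  rw [smallC]
  linarith

/-- The bound of Kleinberg, Sawin and Speyer on tricolored sum-free sets, up to the factor `3`. -/
theorem card_le_of_tricolored_rpow {p d : ℕ} [Fact p.Prime] {S : Type*} [Fintype S]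
    (u v w : S → Fin d → ZMod p)
    (h : ∀ s t r, u s + v t + w r = 0 ↔ s = t ∧ t = r) :
    (Fintype.card S : ℝ) ≤ 3 * ((p : ℝ) ^ d) ^ (1 - smallC p) := by
  have hp := (Fact.out : p.Prime).two_le
  have hp' : (1 : ℝ) < p := by exact_mod_cast hp
  have hB := one_le_sInf_triangleWeight (p := p) (by omega)
  have hcard : (Fintype.card S : ℝ) ≤ 3 * #(lowMonomials p d) := by
    exact_mod_cast card_le_of_tricolored u v w h
  have hpB : (p : ℝ) ^ (1 - smallC p) = sInf (triangleWeight p '' Set.Ioo 0 1) := by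
    rw [smallC, sub_sub_cancel, Real.rpow_logb (by linarith) hp'.ne' (by linarith)]
  rw [← Real.rpow_natCast, ← Real.rpow_mul (by linarith), mul_comm (d : ℝ),
    Real.rpow_mul (by linarith), hpB, Real.rpow_natCast]
  refine hcard.trans (mul_le_mul_of_nonneg_left ?_ (by norm_num))
  rcases Nat.eq_zero_or_pos d with rfl | hd
  · simpa using card_lowMonomials_le (p := p) (d := 0) (by omega) (x := 1 / 2) (by norm_num)
  · rw [← Real.rpow_natCast, ← Real.rpow_inv_le_iff_of_pos (by positivity) (by linarith)
      (by positivity)]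
    refine le_csInf ⟨_, 1 / 2, by norm_num, rfl⟩ ?_
    rintro _ ⟨x, hx, rfl⟩
    rw [Real.rpow_inv_le_iff_of_pos (by positivity)
      (zero_le_one.trans (one_le_triangleWeight (by omega) hx)) (by positivity), Real.rpow_natCast]
    exact card_lowMonomials_le (by omega) hx

/-! ### Random affine pullbacks -/

/-- The affine map `(u, v) ↦ (A u + a, A v + b)` on pairs. Since `A w - a - b` is determined by
`w = -u - v`, it extends to a map of triangles of `F_p^d` to triangles of `F_p^n` acting on each of
the three coordinates separately. -/
def affinePair {p n d : ℕ}
    (ω : Matrix (Fin n) (Fin d) (ZMod p) × (Fin n → ZMod p) × (Fin n → ZMod p))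
    (g : (Fin d → ZMod p) × (Fin d → ZMod p)) : (Fin n → ZMod p) × (Fin n → ZMod p) :=
  (ω.1.mulVec g.1 + ω.2.1, ω.1.mulVec g.2 + ω.2.2)

/-- The linear combination `q₁ x + q₂ y` of a pair `(x, y)`. -/
def combine {p n : ℕ} (q : ZMod p × ZMod p) (t : (Fin n → ZMod p) × (Fin n → ZMod p)) :
    Fin n → ZMod p :=
  q.1 • t.1 + q.2 • t.2

/-- The three combinations `x`, `y` and `x + y = -z` that determine one vertex of the triangle
`(x, y, z)`. -/
def vertexForms (p : ℕ) : Finset (ZMod p × ZMod p) := {(1, 0), (0, 1), (1, 1)}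

theorem ne_zero_of_mem_vertexForms {p : ℕ} [Fact p.Prime] {q : ZMod p × ZMod p}
    (hq : q ∈ vertexForms p) : q ≠ 0 := by
  simp only [vertexForms, mem_insert, mem_singleton] at hq
  rcases hq with rfl | rfl | rfl <;> simp

section Sampling

variable {p n d : ℕ} [Fact p.Prime]

/-- For fixed `δ ≠ 0` and `A` uniform, the vector `A δ` is uniform. -/
theorem card_mulVec_eq_mul {δ : Fin d → ZMod p} (hδ : δ ≠ 0) (y : Fin n → ZMod p) :
    #{A : Matrix (Fin n) (Fin d) (ZMod p) | A.mulVec δ = y} * p ^ n =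
      Fintype.card (Matrix (Fin n) (Fin d) (ZMod p)) := by
  obtain ⟨l, hl⟩ := Function.ne_iff.mp hδ
  let f : Matrix (Fin n) (Fin d) (ZMod p) →+ (Fin n → ZMod p) :=
    { toFun := fun A => A.mulVec δ
      map_zero' := Matrix.zero_mulVec δ
      map_add' := fun A B => Matrix.add_mulVec A B δ }
  have hsurj : ∀ y, y ∈ Set.range f := fun y => by
    refine ⟨Matrix.of fun i j => if j = l then y i / δ l else 0, ?_⟩
    ext i
    simp only [f, AddMonoidHom.coe_mk, ZeroHom.coe_mk, Matrix.mulVec, dotProduct, Matrix.of_apply,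
      ite_mul, zero_mul, sum_ite_eq', mem_univ, if_true]
    exact div_mul_cancel₀ _ hl
  have h := card_eq_sum_card_fiberwise (s := (univ : Finset (Matrix (Fin n) (Fin d) (ZMod p))))
    (t := univ) (f := f) (fun _ _ => mem_coe.mpr (mem_univ _))
  rw [card_univ] at h
  rw [h, sum_congr rfl fun x _ => AddMonoidHom.card_fiber_eq_of_mem_range f (hsurj x) (hsurj y)]
  simp [f, mul_comm, ZMod.card]

theorem card_affinePair_eq (g : (Fin d → ZMod p) × (Fin d → ZMod p))
    (t : (Fin n → ZMod p) × (Fin n → ZMod p)) :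
    #{ω | affinePair ω g = t} = Fintype.card (Matrix (Fin n) (Fin d) (ZMod p)) := by
  rw [← card_univ]
  refine card_bij' (fun ω _ => ω.1)
    (fun A _ => (A, t.1 - A.mulVec g.1, t.2 - A.mulVec g.2)) ?_ ?_ ?_ ?_
  · intros; exact mem_univ _
  · intro A _
    rw [mem_filter]
    simp [affinePair]
  · rintro ⟨A, a, b⟩ h
    simp only [mem_filter, mem_univ, true_and] at h
    simp [← h, affinePair]
  · intros; rfl

/-- Two distinct pairs are mapped to a prescribed pair of pairs with probability at most
`N ^ (-3)`. -/
theorem card_affinePair_eq_and_eq_mul_le {g g' : (Fin d → ZMod p) × (Fin d → ZMod p)} (hg : g ≠ g')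
    (t t' : (Fin n → ZMod p) × (Fin n → ZMod p)) :
    #{ω | affinePair ω g = t ∧ affinePair ω g' = t'} * p ^ n ≤
      Fintype.card (Matrix (Fin n) (Fin d) (ZMod p)) := by
  have key : ∀ δ y, δ ≠ 0 → (∀ ω, affinePair ω g = t ∧ affinePair ω g' = t' →
      ω.1.mulVec δ = y) → #{ω | affinePair ω g = t ∧ affinePair ω g' = t'} * p ^ n ≤
      Fintype.card (Matrix (Fin n) (Fin d) (ZMod p)) := by
    intro δ y hδ h
    rw [← card_mulVec_eq_mul hδ y]
    refine Nat.mul_le_mul_right _ (card_le_card_of_injOn (fun ω => ω.1) ?_ ?_)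
    · intro ω hω
      simpa using h ω (by simpa using hω)
    · rintro ⟨A, a, b⟩ h1 ⟨A', a', b'⟩ h2 (rfl : A = A')
      simp only [coe_filter, mem_univ, true_and, Set.mem_ofPred_eq] at h1 h2
      have h3 := h1.1.trans h2.1.symm
      simp only [affinePair, Prod.mk.injEq, add_right_inj] at h3
      rw [h3.1, h3.2]
  by_cases h1 : g.1 = g'.1
  · have h2 : g'.2 - g.2 ≠ 0 := fun h => hg (Prod.ext h1 (sub_eq_zero.mp h).symm)
    refine key _ (t'.2 - t.2) h2 fun ω hω => ?_
    rw [← hω.1, ← hω.2, Matrix.mulVec_sub]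
    simp [affinePair]
  · have h2 : g'.1 - g.1 ≠ 0 := fun h => h1 (sub_eq_zero.mp h).symm
    refine key _ (t'.1 - t.1) h2 fun ω hω => ?_
    rw [← hω.1, ← hω.2, Matrix.mulVec_sub]
    simp [affinePair]

theorem combine_affinePair_eq {q : ZMod p × ZMod p}
    {g g' : (Fin d → ZMod p) × (Fin d → ZMod p)} (h : combine q g = combine q g')
    (ω : Matrix (Fin n) (Fin d) (ZMod p) × (Fin n → ZMod p) × (Fin n → ZMod p)) :
    combine q (affinePair ω g) = combine q (affinePair ω g') := by
  have h1 := congrArg ω.1.mulVec h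
  simp only [combine, Matrix.mulVec_add, Matrix.mulVec_smul] at h1
  simp only [combine, affinePair, smul_add]
  rw [add_add_add_comm, h1, add_add_add_comm]

theorem card_combine_eq_le {q : ZMod p × ZMod p} (hq : q ≠ 0) (y : Fin d → ZMod p) :
    #{g | combine q g = y} ≤ p ^ d := by
  have hW : p ^ d = #(univ : Finset (Fin d → ZMod p)) := by simp [ZMod.card]
  rw [hW]
  by_cases h1 : q.1 = 0
  · have h2 : q.2 ≠ 0 := fun h => hq (Prod.ext h1 h)
    refine card_le_card_of_injOn Prod.fst (fun _ _ => mem_coe.mpr (mem_univ _)) ?_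
    rintro ⟨u, v⟩ h ⟨u', v'⟩ h' (rfl : u = u')
    simp only [coe_filter, mem_univ, true_and, Set.mem_ofPred_eq] at h h'
    have := h.trans h'.symm
    simp only [combine, add_right_inj] at this
    rw [smul_right_injective _ h2 this]
  · refine card_le_card_of_injOn Prod.snd (fun _ _ => mem_coe.mpr (mem_univ _)) ?_
    rintro ⟨u, v⟩ h ⟨u', v'⟩ h' (rfl : v = v')
    simp only [coe_filter, mem_univ, true_and, Set.mem_ofPred_eq] at h h'
    have := h.trans h'.symm
    simp only [combine, add_left_inj] at this
    rw [smul_right_injective _ h1 this]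

/-- Expected number of pairs of distinct triangles with a common vertex in a random pullback. -/
theorem sum_card_conflicts_le (T : Finset ((Fin n → ZMod p) × (Fin n → ZMod p)))
    {q : ZMod p × ZMod p} (hq : q ≠ 0) {Δ : ℝ}
    (hΔ : ∀ t ∈ T, (#{t' ∈ T | combine q t = combine q t'} : ℝ) ≤ Δ) :
    (∑ ω, (#{e : ((Fin d → ZMod p) × (Fin d → ZMod p)) × ((Fin d → ZMod p) × (Fin d → ZMod p)) |
      (e.1 ≠ e.2 ∧ combine q e.1 = combine q e.2) ∧ affinePair ω e.1 ∈ T ∧ affinePair ω e.2 ∈ T} :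
        ℝ)) * (p : ℝ) ^ n ≤
      ((p : ℝ) ^ d) ^ 3 * (#T * Δ * Fintype.card (Matrix (Fin n) (Fin d) (ZMod p))) := by
  classical
  set a := Fintype.card (Matrix (Fin n) (Fin d) (ZMod p))
  let W := (Fin d → ZMod p) × (Fin d → ZMod p)
  let P : Finset (W × W) := {e | e.1 ≠ e.2 ∧ combine q e.1 = combine q e.2}
  have hP : (#P : ℝ) ≤ ((p : ℝ) ^ d) ^ 3 := by
    have h1 : #P ≤ ∑ g : W, #{g' : W | combine q g' = combine q g} := by
      rw [← card_sigma]
      refine card_le_card_of_injOn (fun e => ⟨e.1, e.2⟩) ?_ ?_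
      · intro e he
        simp only [P, coe_filter, mem_univ, true_and, Set.mem_ofPred_eq] at he
        simp [he.2]
      · rintro ⟨g, g'⟩ _ ⟨k, k'⟩ _ h
        simpa using h
    have h2 : ∑ g : W, #{g' : W | combine q g' = combine q g} ≤ ∑ _g : W, p ^ d :=
      sum_le_sum fun g _ => card_combine_eq_le hq _
    have h3 : ∑ _g : W, p ^ d = (p ^ d) ^ 3 := by
      simp [W, ZMod.card]; ring
    exact_mod_cast h1.trans (h2.trans h3.le)
  let R : Finset (((Fin n → ZMod p) × (Fin n → ZMod p)) × ((Fin n → ZMod p) × (Fin n → ZMod p))) :=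
    {t ∈ T ×ˢ T | combine q t.1 = combine q t.2}
  have hR : (#R : ℝ) ≤ #T * Δ := by
    have h1 : #R = ∑ t ∈ T, #{t' ∈ T | combine q t = combine q t'} := by
      rw [← card_sigma]
      refine card_bij' (fun e _ => ⟨e.1, e.2⟩) (fun e _ => (e.1, e.2)) ?_ ?_ ?_ ?_
      · intro e he
        simp only [R, mem_filter, mem_product] at he
        simp [he]
      · intro e he
        simp only [mem_sigma, mem_filter] at he
        simp [R, he]
      · intros; rfl
      · intros; rfl
    rw [h1, Nat.cast_sum, ← nsmul_eq_mul]
    exact sum_le_card_nsmul _ _ _ hΔ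
  have hfix : ∀ e ∈ P, (#{ω | affinePair ω e.1 ∈ T ∧ affinePair ω e.2 ∈ T} : ℝ) * (p : ℝ) ^ n ≤
      #T * Δ * a := by
    intro e he
    simp only [P, mem_filter, mem_univ, true_and] at he
    have h1 : #{ω | affinePair ω e.1 ∈ T ∧ affinePair ω e.2 ∈ T} * p ^ n ≤ #R * a := by
      rw [card_eq_sum_card_fiberwise (t := R)
        (f := fun ω => (affinePair ω e.1, affinePair ω e.2)), sum_mul, ← smul_eq_mul (#R)]
      · refine sum_le_card_nsmul _ _ _ fun t _ => ?_
        refine (Nat.mul_le_mul_right _ (card_le_card fun ω hω => ?_)).trans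
          (card_affinePair_eq_and_eq_mul_le he.1 t.1 t.2)
        simp only [mem_filter, mem_univ, true_and] at hω ⊢
        exact Prod.ext_iff.mp hω.2
      · intro ω hω
        simp only [coe_filter, mem_univ, true_and, Set.mem_ofPred_eq] at hω
        simp [R, hω, combine_affinePair_eq he.2 ω]
    have h2 : (#{ω | affinePair ω e.1 ∈ T ∧ affinePair ω e.2 ∈ T} : ℝ) * (p : ℝ) ^ n ≤ #R * a := by
      exact_mod_cast h1
    exact h2.trans (mul_le_mul_of_nonneg_right hR (Nat.cast_nonneg _))
  have hswap : (∑ ω, #{e : W × W | (e.1 ≠ e.2 ∧ combine q e.1 = combine q e.2) ∧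
      affinePair ω e.1 ∈ T ∧ affinePair ω e.2 ∈ T}) =
      ∑ e ∈ P, #{ω | affinePair ω e.1 ∈ T ∧ affinePair ω e.2 ∈ T} := by
    simp_rw [← filter_filter (fun e : W × W => e.1 ≠ e.2 ∧ combine q e.1 = combine q e.2)]
    exact sum_card_bipartiteAbove_eq_sum_card_bipartiteBelow
      (fun ω (e : W × W) => affinePair ω e.1 ∈ T ∧ affinePair ω e.2 ∈ T) (s := univ) (t := P)
  have hΔ0 : 0 ≤ #T * Δ * (a : ℝ) :=
    mul_nonneg ((Nat.cast_nonneg _).trans hR) (Nat.cast_nonneg _)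
  rw [← Nat.cast_sum, hswap, Nat.cast_sum, sum_mul]
  refine (sum_le_card_nsmul _ _ _ hfix).trans ?_
  rw [nsmul_eq_mul]
  exact mul_le_mul_of_nonneg_right hP hΔ0

theorem sum_card_affinePair_mem (T : Finset ((Fin n → ZMod p) × (Fin n → ZMod p))) :
    ∑ ω, #{g : (Fin d → ZMod p) × (Fin d → ZMod p) | affinePair ω g ∈ T} =
      (p ^ d) ^ 2 * (#T * Fintype.card (Matrix (Fin n) (Fin d) (ZMod p))) := by
  classical
  have h1 := sum_card_bipartiteAbove_eq_sum_card_bipartiteBelow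
    (fun ω (g : (Fin d → ZMod p) × (Fin d → ZMod p)) => affinePair ω g ∈ T)
    (s := univ) (t := univ)
  refine h1.trans ?_
  have h2 : ∀ g : (Fin d → ZMod p) × (Fin d → ZMod p),
      #{ω | affinePair ω g ∈ T} = #T * Fintype.card (Matrix (Fin n) (Fin d) (ZMod p)) := by
    intro g
    rw [card_eq_sum_card_fiberwise (t := T) (f := fun ω => affinePair ω g)
      (fun ω hω => by simpa using hω), ← smul_eq_mul, ← sum_const]
    refine sum_congr rfl fun t ht => ?_
    rw [← card_affinePair_eq g t, filter_filter]
    congr 1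
    ext ω
    simp only [mem_filter, mem_univ, true_and, and_iff_right_iff_imp]
    rintro rfl
    exact ht
  refine (sum_congr rfl fun g _ => h2 g).trans ?_
  rw [sum_const, card_univ, smul_eq_mul, Fintype.card_prod, Fintype.card_fun, ZMod.card,
    Fintype.card_fin]
  ring

/-- The triangles in `X × Y × Z`, each recorded by its first two vertices. -/
def trianglePairs (X Y Z : Finset (Fin n → ZMod p)) :
    Finset ((Fin n → ZMod p) × (Fin n → ZMod p)) :=
  {t ∈ X ×ˢ Y | -(t.1 + t.2) ∈ Z}

/-- In any affine pullback of `X × Y × Z`, the triangles that share no vertex with another triangle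
form a tricolored sum-free set. -/
theorem card_isolated_le (X Y Z : Finset (Fin n → ZMod p))
    (ω : Matrix (Fin n) (Fin d) (ZMod p) × (Fin n → ZMod p) × (Fin n → ZMod p))
    (I : Finset ((Fin d → ZMod p) × (Fin d → ZMod p)))
    (hmem : ∀ g ∈ I, affinePair ω g ∈ trianglePairs X Y Z)
    (hiso : ∀ g ∈ I, ∀ g', affinePair ω g' ∈ trianglePairs X Y Z → ∀ q ∈ vertexForms p,
      combine q g = combine q g' → g = g') :
    (#I : ℝ) ≤ 3 * ((p : ℝ) ^ d) ^ (1 - smallC p) := by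
  rw [← Fintype.card_coe I]
  refine card_le_of_tricolored_rpow (fun g : I => g.1.1) (fun g => g.1.2)
    (fun g => -(g.1.1 + g.1.2)) ?_
  rintro ⟨s, hs⟩ ⟨t, ht⟩ ⟨r, hr⟩
  simp only [Subtype.mk.injEq]
  constructor
  · intro h
    have h' : s.1 + t.2 = r.1 + r.2 := by rwa [← sub_eq_add_neg, sub_eq_zero] at h
    have hst : affinePair ω (s.1, t.2) ∈ trianglePairs X Y Z := by
      have h1 := hmem s hs
      have h2 := hmem t ht
      have h3 := hmem r hr
      simp only [trianglePairs, affinePair, mem_filter, mem_product] at h1 h2 h3 ⊢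
      refine ⟨⟨h1.1.1, h2.1.2⟩, ?_⟩
      rw [add_add_add_comm, ← Matrix.mulVec_add] at h3 ⊢
      rw [h']
      exact h3.2
    have e1 := hiso s hs _ hst (1, 0) (by simp [vertexForms]) (by simp [combine])
    have e2 := hiso t ht _ hst (0, 1) (by simp [vertexForms]) (by simp [combine])
    have e3 := hiso r hr _ hst (1, 1) (by simp [vertexForms]) (by simp [combine, h'])
    exact ⟨e1.trans e2.symm, e2.trans e3.symm⟩
  · rintro ⟨rfl, rfl⟩
    exact add_neg_cancel _

/-- If every vertex lies in at most `Δ` triangles of `X × Y × Z`, then pulling back to a random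
`d`-dimensional space with `p ^ d ≤ N / (6 Δ)` leaves at least half of the triangles isolated on
average. -/
theorem sq_mul_card_trianglePairs_le (X Y Z : Finset (Fin n → ZMod p)) {Δ : ℝ}
    (hΔ : ∀ q ∈ vertexForms p, ∀ t ∈ trianglePairs X Y Z,
      (#{t' ∈ trianglePairs X Y Z | combine q t = combine q t'} : ℝ) ≤ Δ)
    (hd : 6 * (p : ℝ) ^ d * Δ ≤ (p : ℝ) ^ n) :
    ((p : ℝ) ^ d) ^ 2 * #(trianglePairs X Y Z) ≤
      6 * ((p : ℝ) ^ n) ^ 2 * ((p : ℝ) ^ d) ^ (1 - smallC p) := by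
  classical
  set T := trianglePairs X Y Z with hT
  set a := Fintype.card (Matrix (Fin n) (Fin d) (ZMod p))
  have ha : (0 : ℝ) < a := by exact_mod_cast Fintype.card_pos
  have hp : (0 : ℝ) < p := by exact_mod_cast (Fact.out : p.Prime).pos
  set D := (p : ℝ) ^ d with hD
  set N := (p : ℝ) ^ n with hN
  have hDpos : 0 < D := by positivity
  have hNpos : 0 < N := by positivity
  let W := (Fin d → ZMod p) × (Fin d → ZMod p)
  let conf (ω : Matrix (Fin n) (Fin d) (ZMod p) × (Fin n → ZMod p) × (Fin n → ZMod p))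
      (q : ZMod p × ZMod p) : Finset (W × W) :=
    {e | (e.1 ≠ e.2 ∧ combine q e.1 = combine q e.2) ∧ affinePair ω e.1 ∈ T ∧ affinePair ω e.2 ∈ T}
  have hω : ∀ ω, (#{g : W | affinePair ω g ∈ T} : ℝ) ≤
      3 * D ^ (1 - smallC p) + ∑ q ∈ vertexForms p, (#(conf ω q) : ℝ) := by
    intro ω
    set I : Finset W := {g : W | affinePair ω g ∈ T ∧
      ∀ g', affinePair ω g' ∈ T → ∀ q ∈ vertexForms p, combine q g = combine q g' → g = g'} with hI
    have hmem : ∀ g ∈ I, affinePair ω g ∈ T ∧ ∀ g', affinePair ω g' ∈ T → ∀ q ∈ vertexForms p,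
        combine q g = combine q g' → g = g' := by
      intro g hg
      rw [hI, mem_filter] at hg
      exact hg.2
    have hI' : (#I : ℝ) ≤ 3 * D ^ (1 - smallC p) :=
      card_isolated_le X Y Z ω I (fun g hg => (hmem g hg).1) fun g hg => (hmem g hg).2
    have hsub : ({g : W | affinePair ω g ∈ T} : Finset W) ⊆
        I ∪ (vertexForms p).biUnion fun q => (conf ω q).image Prod.fst := by
      intro g hg
      rw [mem_filter] at hg
      rw [mem_union, or_iff_not_imp_left]
      intro hgI
      simp only [hI, mem_filter, mem_univ, true_and, not_and, not_forall] at hgI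
      obtain ⟨g', hg', q, hq, hc, hne⟩ := hgI hg.2
      exact mem_biUnion.mpr ⟨q, hq, mem_image.mpr ⟨(g, g'),
        mem_filter.mpr ⟨mem_univ _, ⟨hne, hc⟩, hg.2, hg'⟩, rfl⟩⟩
    have h1 : #({g : W | affinePair ω g ∈ T} : Finset W) ≤
        #I + ∑ q ∈ vertexForms p, #(conf ω q) :=
      (card_le_card hsub).trans <| (card_union_le _ _).trans <| Nat.add_le_add_left
        (card_biUnion_le.trans (sum_le_sum fun q _ => card_image_le)) _
    have h2 : (#({g : W | affinePair ω g ∈ T} : Finset W) : ℝ) ≤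
        #I + ∑ q ∈ vertexForms p, (#(conf ω q) : ℝ) := by exact_mod_cast h1
    linarith
  have hsum := sum_le_sum fun ω (_ : ω ∈ univ) => hω ω
  rw [← Nat.cast_sum, sum_card_affinePair_mem, sum_add_distrib, sum_comm, sum_const, card_univ,
    nsmul_eq_mul] at hsum
  have hΩ : (Fintype.card (Matrix (Fin n) (Fin d) (ZMod p) × (Fin n → ZMod p) ×
      (Fin n → ZMod p)) : ℝ) = a * N ^ 2 := by
    simp only [Fintype.card_prod, Fintype.card_fun, ZMod.card, Fintype.card_fin, hN, a]
    push_cast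
    ring
  rw [hΩ] at hsum
  have hconf : ∑ q ∈ vertexForms p, ∑ ω, (#(conf ω q) : ℝ) ≤ 3 * (D ^ 3 * (#T * Δ * a) / N) := by
    have h3 : #(vertexForms p) ≤ 3 := card_le_three
    by_cases hTe : T = ∅
    · simp [conf, hTe]
    obtain ⟨t, ht⟩ := nonempty_iff_ne_empty.mpr hTe
    have hΔ0 : 0 ≤ Δ := (Nat.cast_nonneg _).trans (hΔ (1, 0) (by simp [vertexForms]) t ht)
    refine (sum_le_card_nsmul _ _ (D ^ 3 * (#T * Δ * a) / N) fun q hq => ?_).trans ?_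
    · rw [le_div_iff₀ hNpos]
      exact sum_card_conflicts_le T (ne_zero_of_mem_vertexForms hq) (hΔ q hq)
    · rw [nsmul_eq_mul]
      refine mul_le_mul_of_nonneg_right (by exact_mod_cast h3) (by positivity)
  have hhalf : 3 * (D ^ 3 * (#T * Δ * a) / N) ≤ D ^ 2 * #T * a / 2 := by
    have : 3 * (D ^ 3 * (#T * Δ * a) / N) = (6 * D * Δ) * (D ^ 2 * #T * a / (2 * N)) := by
      field_simp
      ring
    rw [this]
    refine (mul_le_mul_of_nonneg_right hd (by positivity)).trans_eq ?_
    field_simp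
  push_cast at hsum
  rw [← hD] at hsum
  refine le_of_mul_le_mul_right ?_ ha
  linarith

end Sampling

/-! ### Regularization of the matching -/

/-- Regularization. Here `T I` is the set of triangles spanned by the matching triangles with index
in `I`, and `v q t` is the vertex of `t` of kind `q`. After deleting less than a proportion
`∑ j, 1 / ((j + 1) (j + 2)) = 1` of the matching, one reaches a stage `j` at which all degrees are
at most `N / 2 ^ j` while the number of triangles is within a factor `O(j ^ 2)` of the maximum
that this allows. -/
theorem exists_nearly_regular {ι E V Q : Type*} [Fintype ι] [Nonempty ι]
    [DecidableEq V] (T : Finset ι → Finset E) (hT : Monotone T)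
    (hne : ∀ I, I.Nonempty → (T I).Nonempty) (F : Finset Q) (hF : #F ≤ 3) (hF0 : F.Nonempty)
    (v : Q → E → V) (l : Q → ι → V) (hl : ∀ q ∈ F, Function.Injective (l q))
    (hv : ∀ I, ∀ t ∈ T I, ∀ q ∈ F, ∃ i ∈ I, v q t = l q i) {N : ℝ} (hN : 0 < N)
    (hdeg : ∀ q ∈ F, ∀ t ∈ T univ, (#{t' ∈ T univ | v q t = v q t'} : ℝ) ≤ N) :
    ∃ (j : ℕ) (I : Finset ι),
      (∀ q ∈ F, ∀ t ∈ T I, (#{t' ∈ T I | v q t = v q t'} : ℝ) ≤ N / 2 ^ j) ∧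
      N / 2 ^ j * (Fintype.card ι / ((j + 1) * (j + 2))) ≤ 6 * (#(T I) : ℝ) := by
  classical
  by_contra! hcon
  set m : ℝ := (Fintype.card ι : ℝ) with hm
  have hmpos : 0 < m := Nat.cast_pos.mpr Fintype.card_pos
  have key : ∀ j : ℕ, ∃ I : Finset ι,
      (∀ q ∈ F, ∀ t ∈ T I, (#{t' ∈ T I | v q t = v q t'} : ℝ) ≤ N / 2 ^ j) ∧
        m / (j + 1) ≤ #I := by
    intro j
    induction j with
    | zero => exact ⟨univ, by simpa using hdeg, by simp [hm]⟩
    | succ j ih =>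
      obtain ⟨I, hI, hcard⟩ := ih
      have hfew := hcon j I hI
      let B : Q → Finset ι := fun q => {i ∈ I | N / 2 ^ (j + 1) < #{t' ∈ T I | l q i = v q t'}}
      -- Delete every index one of whose vertices has degree more than `N / 2 ^ (j + 1)`.
      refine ⟨I \ F.biUnion B, fun q hq t ht => ?_, ?_⟩
      · obtain ⟨i, hi, hti⟩ := hv _ t ht q hq
        rw [Finset.mem_sdiff, mem_biUnion] at hi
        have hiB : i ∉ B q := fun h => hi.2 ⟨q, hq, h⟩
        simp only [B, mem_filter, hi.1, true_and, not_lt] at hiB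
        rw [hti]
        refine le_trans ?_ hiB
        exact_mod_cast card_le_card (filter_subset_filter _ (hT sdiff_subset))
      · have hB : ∀ q ∈ F, (#(B q) : ℝ) ≤ #(T I) / (N / 2 ^ (j + 1)) := by
          intro q hq
          rw [le_div_iff₀ (by positivity)]
          have h1 : ∑ i ∈ B q, #{t' ∈ T I | l q i = v q t'} ≤ #(T I) := by
            rw [← card_biUnion]
            · exact card_le_card (biUnion_subset.mpr fun i _ => filter_subset _ _)
            · intro i _ i' _ hii'
              refine disjoint_filter.mpr fun t _ h h' => hii' (hl q hq (h.trans h'.symm))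
          have h2 : #(B q) • (N / 2 ^ (j + 1)) ≤
              ∑ i ∈ B q, (#{t' ∈ T I | l q i = v q t'} : ℝ) :=
            card_nsmul_le_sum _ _ _ fun i hi => (mem_filter.mp hi).2.le
          rw [nsmul_eq_mul] at h2
          exact h2.trans (by exact_mod_cast h1)
        have hU : (#(F.biUnion B) : ℝ) ≤ 3 * (#(T I) / (N / 2 ^ (j + 1))) := by
          calc (#(F.biUnion B) : ℝ) ≤ ∑ q ∈ F, (#(B q) : ℝ) := by exact_mod_cast card_biUnion_le
            _ ≤ #F • (#(T I) / (N / 2 ^ (j + 1))) := sum_le_card_nsmul _ _ _ hB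
            _ ≤ _ := by
              rw [nsmul_eq_mul]
              exact mul_le_mul_of_nonneg_right (by exact_mod_cast hF) (by positivity)
        have hU2 : (#(F.biUnion B) : ℝ) ≤ m / ((j + 1) * (j + 2)) := by
          refine hU.trans ?_
          have h3 : 3 * (#(T I) / (N / 2 ^ (j + 1))) = 6 * (#(T I) : ℝ) / (N / 2 ^ j) := by
            rw [pow_succ]; field_simp; ring
          rw [h3, div_le_iff₀ (by positivity)]
          linarith
        have h4 : (#I : ℝ) ≤ #(I \ F.biUnion B) + #(F.biUnion B) := by
          exact_mod_cast card_le_card_sdiff_add_card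
        have h5 : m / (j + 1) - m / ((j + 1) * (j + 2)) = m / ((j + 1 : ℕ) + 1) := by
          push_cast; field_simp; ring
        linarith
  obtain ⟨j, hj⟩ := pow_unbounded_of_one_lt N one_lt_two
  obtain ⟨I, hI, hcard⟩ := key j
  have hIpos : (0 : ℝ) < #I := lt_of_lt_of_le (by positivity) hcard
  obtain ⟨t, ht⟩ := hne I (card_pos.mp (by exact_mod_cast hIpos))
  obtain ⟨q, hq⟩ := hF0
  have h1 := hI q hq t ht
  have h2 : (1 : ℝ) ≤ #{t' ∈ T I | v q t = v q t'} := by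
    exact_mod_cast card_pos.mpr ⟨t, by simp [ht]⟩
  have h3 : N / 2 ^ j < 1 := by rwa [div_lt_one (by positivity)]
  linarith

section Matching

variable {p n m : ℕ} [Fact p.Prime]

theorem card_trianglePairs_le (X Y Z : Finset (Fin n → ZMod p)) :
    #(trianglePairs X Y Z) ≤ triangleCount X Y Z := by
  refine card_le_card_of_injOn (fun t => (t.1, t.2, -(t.1 + t.2))) ?_ ?_
  · intro t ht
    simp only [trianglePairs, coe_filter, mem_product, Set.mem_ofPred_eq] at ht
    simp only [coe_filter, mem_product, Set.mem_ofPred_eq, add_neg_cancel, and_true]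
    exact ⟨ht.1.1, ht.1.2, ht.2⟩
  · rintro ⟨u, v⟩ _ ⟨u', v'⟩ _ h
    simp only [Prod.mk.injEq] at h
    rw [h.1, h.2.1]

theorem trianglePairs_mono {X X' Y Y' Z Z' : Finset (Fin n → ZMod p)} (hX : X ⊆ X') (hY : Y ⊆ Y')
    (hZ : Z ⊆ Z') : trianglePairs X Y Z ⊆ trianglePairs X' Y' Z' := by
  intro t ht
  simp only [trianglePairs, mem_filter, mem_product] at ht ⊢
  exact ⟨⟨hX ht.1.1, hY ht.1.2⟩, hZ ht.2⟩

theorem card_le_of_isDisjointTriangleFamily {x y z : Fin m → Fin n → ZMod p}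
    (h : IsDisjointTriangleFamily x y z) : (m : ℝ) ≤ (p : ℝ) ^ n := by
  have := Fintype.card_le_of_injective x h.injective_fst
  rw [Fintype.card_fin, Fintype.card_fun, ZMod.card, Fintype.card_fin] at this
  exact_mod_cast this

/-- The triangles of a regularized submatching of size controlled by the stage `j`, together with
the upper bound on `j` that the sum-free set theorem imposes. -/
theorem exists_scale {x y z : Fin m → Fin n → ZMod p} (h : IsDisjointTriangleFamily x y z) {ε : ℝ}
    (hε : 0 < ε) (hm : (m : ℝ) = ε * (p : ℝ) ^ n) :
    ∃ j : ℕ,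
      (2 ^ j : ℝ) ^ smallC p * (ε / ((j + 1) * (j + 2))) ≤ 1296 * (p : ℝ) ^ 2 ∧
      ε / ((j + 1) * (j + 2)) / (6 * 2 ^ j) * ((p : ℝ) ^ n) ^ 2 ≤
        triangleCount (univ.image x) (univ.image y) (univ.image z) := by
  classical
  have hp2 := (Fact.out : p.Prime).two_le
  have hp : (2 : ℝ) ≤ p := by exact_mod_cast hp2
  have hc0 := smallC_pos hp2
  have hc1 := smallC_le_one hp2
  set c := smallC p
  set N := (p : ℝ) ^ n with hNdef
  have hN : 0 < N := by positivity
  have hε1 : ε ≤ 1 := by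
    have := card_le_of_isDisjointTriangleFamily h
    rw [hm] at this
    exact le_of_mul_le_mul_right (by rwa [one_mul]) hN
  have hm0 : 0 < m := by
    have : (0 : ℝ) < m := by rw [hm]; positivity
    exact_mod_cast this
  have : Nonempty (Fin m) := ⟨⟨0, hm0⟩⟩
  let T : Finset (Fin m) → Finset ((Fin n → ZMod p) × (Fin n → ZMod p)) := fun I =>
    trianglePairs (I.image x) (I.image y) (I.image z)
  have hz : ∀ i, z i = -(x i + y i) := fun i =>
    (neg_eq_of_add_eq_zero_right (h.sum_eq_zero i)).symm
  have hTmono : Monotone T := fun I J hIJ =>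
    trianglePairs_mono (image_subset_image hIJ) (image_subset_image hIJ) (image_subset_image hIJ)
  obtain ⟨j, I, hI, hcard⟩ := exists_nearly_regular T hTmono
    (by
      rintro I ⟨i, hi⟩
      refine ⟨(x i, y i), ?_⟩
      simp only [T, trianglePairs, mem_filter, mem_product]
      exact ⟨⟨mem_image_of_mem _ hi, mem_image_of_mem _ hi⟩, hz i ▸ mem_image_of_mem _ hi⟩)
    (vertexForms p) card_le_three ⟨(1, 0), by simp [vertexForms]⟩
    combine (fun q i => combine q (x i, y i))
    (by
      intro q hq
      simp only [vertexForms, mem_insert, mem_singleton] at hq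
      rcases hq with rfl | rfl | rfl <;> intro i i' hii'
      · exact h.injective_fst (by simpa [combine] using hii')
      · exact h.injective_snd (by simpa [combine] using hii')
      · refine h.injective_trd ?_
        rw [hz, hz, neg_inj]
        simpa [combine] using hii')
    (by
      intro I t ht q hq
      simp only [T, trianglePairs, mem_filter, mem_product, mem_image] at ht
      obtain ⟨⟨⟨i, hi, hi'⟩, ⟨k, hk, hk'⟩⟩, ⟨r, hr, hr'⟩⟩ := ht
      simp only [vertexForms, mem_insert, mem_singleton] at hq
      rcases hq with rfl | rfl | rfl
      · exact ⟨i, hi, by simp [combine, hi']⟩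
      · exact ⟨k, hk, by simp [combine, hk']⟩
      · refine ⟨r, hr, ?_⟩
        rw [hz, neg_inj] at hr'
        simp [combine, hr'])
    hN
    (by
      intro q hq t _
      have h1 : #{t' ∈ T univ | combine q t = combine q t'} ≤ p ^ n :=
        (card_le_card fun t' ht' => by
          simp only [mem_filter, mem_univ, true_and] at ht' ⊢
          exact ht'.2.symm).trans
            (card_combine_eq_le (ne_zero_of_mem_vertexForms hq) (combine q t))
      rw [hNdef]
      exact_mod_cast h1)
  rw [Fintype.card_fin, hm] at hcard
  set w : ℝ := ε / ((j + 1) * (j + 2)) with hw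
  have hw0 : 0 < w := by positivity
  have hw1 : w ≤ 1 := by
    refine (div_le_one (by positivity)).mpr (hε1.trans ?_)
    have : (0 : ℝ) ≤ j := Nat.cast_nonneg j
    nlinarith
  set q : ℝ := 2 ^ j with hq
  have hq1 : 1 ≤ q := one_le_pow₀ one_le_two
  have hT : w * N ^ 2 / (6 * q) ≤ #(T I) := by
    have : w * N ^ 2 / (6 * q) = N / q * (ε * N / ((j + 1) * (j + 2))) / 6 := by
      rw [hw]; field_simp
    rw [this]
    linarith
  refine ⟨j, ?_, ?_⟩
  · rcases lt_or_ge q 6 with hq6 | hq6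
    · have h1 : q ^ c ≤ 6 := by
        refine (Real.rpow_le_rpow_of_exponent_le hq1 hc1).trans ?_
        rw [Real.rpow_one]
        exact hq6.le
      have h2 : q ^ c * w ≤ 6 * 1 := mul_le_mul h1 hw1 hw0.le (by norm_num)
      nlinarith
    -- `D = p ^ d` is the largest power of `p` with `6 D ≤ 2 ^ j`.
    · obtain ⟨d, hd1, hd2⟩ := exists_nat_pow_near (x := q / 6) (y := (p : ℝ))
        ((one_le_div (by norm_num)).mpr hq6) (by linarith)
      have hs := sq_mul_card_trianglePairs_le (d := d) (I.image x) (I.image y) (I.image z) hI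
        (by
          rw [← hNdef]
          calc 6 * (p : ℝ) ^ d * (N / q) ≤ q * (N / q) :=
                mul_le_mul_of_nonneg_right (by linarith) (by positivity)
            _ = N := by field_simp)
      rw [← hNdef] at hs
      set D := (p : ℝ) ^ d with hD
      have hD0 : 0 < D := by positivity
      have hqD : q ≤ 6 * p * D := by rw [pow_succ] at hd2; linarith
      have h1 : D ^ 2 * (w * N ^ 2 / (6 * q)) ≤ 6 * N ^ 2 * D ^ (1 - c) :=
        (mul_le_mul_of_nonneg_left hT (by positivity)).trans hs
      have h2 : D ^ (1 - c) = D / D ^ c := by rw [Real.rpow_sub hD0, Real.rpow_one]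
      have hDc : 0 < D ^ c := Real.rpow_pos_of_pos hD0 c
      rw [h2] at h1
      have h3 : D ^ c * w * D ≤ 36 * q := by
        have e1 : D ^ 2 * (w * N ^ 2 / (6 * q)) =
            D ^ c * w * D * (D * N ^ 2 / (6 * q * D ^ c)) := by
          field_simp
        have e2 : 6 * N ^ 2 * (D / D ^ c) = 36 * q * (D * N ^ 2 / (6 * q * D ^ c)) := by
          field_simp; ring
        rw [e1, e2] at h1
        exact le_of_mul_le_mul_right h1 (by positivity)
      have h4 : D ^ c * w ≤ 216 * p := by
        refine le_of_mul_le_mul_right (h3.trans ?_) hD0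
        linarith
      have h5 : q ^ c ≤ 6 * p * D ^ c := by
        calc q ^ c ≤ (6 * p * D) ^ c := Real.rpow_le_rpow (by positivity) hqD hc0.le
          _ = (6 * p) ^ c * D ^ c := Real.mul_rpow (by positivity) hD0.le
          _ ≤ 6 * p * D ^ c := by
            refine mul_le_mul_of_nonneg_right ?_ hDc.le
            calc (6 * p : ℝ) ^ c ≤ (6 * p) ^ (1 : ℝ) :=
                  Real.rpow_le_rpow_of_exponent_le (by linarith) hc1
              _ = 6 * p := Real.rpow_one _
      calc q ^ c * w ≤ 6 * p * D ^ c * w := mul_le_mul_of_nonneg_right h5 hw0.le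
        _ = 6 * p * (D ^ c * w) := by ring
        _ ≤ 6 * p * (216 * p) := mul_le_mul_of_nonneg_left h4 (by positivity)
        _ = 1296 * (p : ℝ) ^ 2 := by ring
  · have h1 : (#(T I) : ℝ) ≤ triangleCount (univ.image x) (univ.image y) (univ.image z) := by
      have := (card_le_card (hTmono (subset_univ I))).trans (card_trianglePairs_le _ _ _)
      exact_mod_cast this
    refine le_trans (le_of_eq ?_) (hT.trans h1)
    ring

end Matching

/-! ### From scales to densities -/

theorem exists_mul_le_two_pow_rpow {c : ℝ} (hc0 : 0 < c) (hc1 : c ≤ 1) :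
    ∃ C : ℝ, 1 ≤ C ∧ ∀ j : ℕ, ((j : ℝ) + 1) * (j + 2) ≤ C * (2 ^ j : ℝ) ^ (c / 2) := by
  -- Bernoulli's inequality for `a ^ j`, squared.
  set a : ℝ := 2 ^ (c / 4) with ha
  have ha1 : 1 < a := Real.one_lt_rpow one_lt_two (by positivity)
  have ha2 : a ≤ 2 := by
    calc a ≤ 2 ^ (1 : ℝ) := Real.rpow_le_rpow_of_exponent_le one_le_two (by linarith)
      _ = 2 := Real.rpow_one 2
  have hb : 0 < a - 1 := by linarith
  refine ⟨2 / (a - 1) ^ 2, ?_, fun j => ?_⟩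
  · rw [one_le_div (by positivity)]
    nlinarith
  · have h1 : (2 ^ j : ℝ) ^ (c / 2) = (a ^ j) ^ 2 := by
      rw [ha, ← Real.rpow_natCast 2 j, ← Real.rpow_natCast _ j, ← Real.rpow_natCast _ 2,
        ← Real.rpow_mul two_pos.le, ← Real.rpow_mul two_pos.le, ← Real.rpow_mul two_pos.le]
      congr 1
      push_cast
      ring
    have h2 : 1 + (j : ℝ) * (a - 1) ≤ a ^ j := by
      have := one_add_mul_le_pow (a := a - 1) (by linarith) j
      rwa [add_sub_cancel] at this
    have hj : (0 : ℝ) ≤ j := Nat.cast_nonneg j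
    have h3 : ((j : ℝ) + 1) * (a - 1) ≤ a ^ j := by linarith
    have h4 : (((j : ℝ) + 1) * (a - 1)) ^ 2 ≤ (a ^ j) ^ 2 := pow_le_pow_left₀ (by positivity) h3 2
    rw [h1, div_mul_eq_mul_div, le_div_iff₀ (by positivity)]
    rw [mul_pow] at h4
    have h5 : ((j : ℝ) + 1) * (j + 2) ≤ 2 * (j + 1) ^ 2 := by nlinarith
    calc ((j : ℝ) + 1) * (j + 2) * (a - 1) ^ 2 ≤ 2 * (j + 1) ^ 2 * (a - 1) ^ 2 :=
          mul_le_mul_of_nonneg_right h5 (by positivity)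
      _ ≤ 2 * (a ^ j) ^ 2 := by linarith

/-- The upper bound on the stage `j` makes it `O(log (2 / ε))`, so that the polynomial loss in `j`
becomes a logarithmic loss in `ε`. -/
theorem exists_lower_bound_of_scale {c A : ℝ} (hc0 : 0 < c) (hc1 : c ≤ 1) (hA : 1 ≤ A) :
    ∃ K : ℝ, 0 < K ∧ ∀ (ε : ℝ) (j : ℕ), 0 < ε → ε ≤ 1 →
      (2 ^ j : ℝ) ^ c * (ε / ((j + 1) * (j + 2))) ≤ A →
      K * (ε ^ (1 + 1 / c) * Real.logb 2 (2 / ε) ^ (-((2 + 2 * c) / c))) ≤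
        ε / ((j + 1) * (j + 2)) / (6 * 2 ^ j) := by
  obtain ⟨C, hC, hCj⟩ := exists_mul_le_two_pow_rpow hc0 hc1
  set M := 2 * (Real.logb 2 (A * C) + 1) / c + 2 with hM
  have hAC : 1 ≤ A * C := one_le_mul_of_one_le_of_one_le hA hC
  have hlogAC : 0 ≤ Real.logb 2 (A * C) := Real.logb_nonneg one_lt_two hAC
  have hM0 : 0 < M := by positivity
  have hA0 : 0 < A := by linarith
  refine ⟨M ^ (-((2 + 2 * c) / c)) * (A ^ (-(1 / c))) / 6, by positivity, ?_⟩
  intro ε j hε hε1 hj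
  set L := Real.logb 2 (2 / ε) with hL
  have hL' : L = 1 + Real.logb 2 (1 / ε) := by
    rw [hL, ← mul_one_div, Real.logb_mul two_ne_zero (by positivity),
      Real.logb_self_eq_one one_lt_two]
  have hL1 : 1 ≤ L := by
    have : 0 ≤ Real.logb 2 (1 / ε) :=
      Real.logb_nonneg one_lt_two ((one_le_div hε).mpr hε1)
    linarith
  have hL0 : 0 < L := by linarith
  set g : ℝ := ((j : ℝ) + 1) * (j + 2) with hg
  have hg0 : 0 < g := by positivity
  set q : ℝ := 2 ^ j with hq
  have hq0 : 0 < q := by positivity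
  have hjM : (j : ℝ) + 2 ≤ M * L := by
    have h1 : q ^ c = q ^ (c / 2) * q ^ (c / 2) := by
      rw [← Real.rpow_add hq0, add_halves]
    have hqc : 0 < q ^ (c / 2) := Real.rpow_pos_of_pos hq0 _
    have h2 : q ^ (c / 2) ≤ A * C * (1 / ε) := by
      have h3 : q ^ c * ε ≤ A * g := by
        rwa [← mul_div_assoc, div_le_iff₀ hg0] at hj
      have h4 : q ^ (c / 2) * ε * q ^ (c / 2) ≤ A * C * q ^ (c / 2) := by
        calc q ^ (c / 2) * ε * q ^ (c / 2) = q ^ c * ε := by rw [h1]; ring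
          _ ≤ A * g := h3
          _ ≤ A * (C * q ^ (c / 2)) := mul_le_mul_of_nonneg_left (hCj j) hA0.le
          _ = _ := by ring
      rw [mul_one_div, le_div_iff₀ hε]
      exact le_of_mul_le_mul_right h4 hqc
    have h3 : (j : ℝ) * (c / 2) ≤ Real.logb 2 (A * C) + Real.logb 2 (1 / ε) := by
      have h4 : Real.logb 2 (q ^ (c / 2)) = j * (c / 2) := by
        rw [Real.logb_rpow_eq_mul_logb_of_pos hq0, hq, Real.logb_pow,
          Real.logb_self_eq_one one_lt_two]
        ring
      rw [← h4, ← Real.logb_mul (by positivity) (by positivity)]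
      exact Real.logb_le_logb_of_le one_lt_two hqc h2
    have h4 : (j : ℝ) * (c / 2) ≤ (Real.logb 2 (A * C) + 1) * L := by nlinarith
    have h5 : (j : ℝ) ≤ 2 * (Real.logb 2 (A * C) + 1) / c * L := by
      rw [div_mul_eq_mul_div, le_div_iff₀ hc0]
      linarith
    rw [hM, add_mul]
    linarith
  have hgM : g ≤ (M * L) ^ (2 : ℝ) := by
    have hj0 : (0 : ℝ) ≤ j := Nat.cast_nonneg j
    rw [Real.rpow_two]
    nlinarith
  have hexp : (2 + 2 * c) / c = 2 * (1 + 1 / c) := by field_simp; ring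
  have hw : ε ^ (1 + 1 / c) * (M * L) ^ (-((2 + 2 * c) / c)) ≤ (ε / g) ^ (1 + 1 / c) := by
    rw [Real.div_rpow hε.le hg0.le, div_eq_mul_inv (ε ^ _), ← Real.rpow_neg hg0.le]
    refine mul_le_mul_of_nonneg_left ?_ (by positivity)
    rw [hexp, ← mul_neg, Real.rpow_mul (by positivity)]
    refine Real.rpow_le_rpow_of_nonpos hg0 hgM ?_
    have : 0 < 1 + 1 / c := by positivity
    linarith
  have hq' : A ^ (-(1 / c)) * (ε / g) ^ (1 / c) ≤ 1 / q := by
    have h1 : ε / g ≤ A * q ^ (-c) := by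
      rw [Real.rpow_neg hq0.le, ← div_eq_mul_inv, le_div_iff₀ (by positivity), mul_comm]
      exact hj
    have h2 : (ε / g) ^ (1 / c) ≤ A ^ (1 / c) * (1 / q) := by
      calc (ε / g) ^ (1 / c) ≤ (A * q ^ (-c)) ^ (1 / c) :=
            Real.rpow_le_rpow (by positivity) h1 (by positivity)
        _ = A ^ (1 / c) * (1 / q) := by
          rw [Real.mul_rpow hA0.le (by positivity), ← Real.rpow_mul hq0.le]
          have : -c * (1 / c) = -1 := by field_simp
          rw [this, Real.rpow_neg_one, one_div q]
    rw [Real.rpow_neg hA0.le, inv_mul_le_iff₀ (by positivity)]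
    exact h2
  calc M ^ (-((2 + 2 * c) / c)) * (A ^ (-(1 / c))) / 6 *
        (ε ^ (1 + 1 / c) * L ^ (-((2 + 2 * c) / c)))
      = A ^ (-(1 / c)) / 6 * (ε ^ (1 + 1 / c) * (M * L) ^ (-((2 + 2 * c) / c))) := by
        rw [Real.mul_rpow hM0.le hL0.le]; ring
    _ ≤ A ^ (-(1 / c)) / 6 * (ε / g) ^ (1 + 1 / c) :=
        mul_le_mul_of_nonneg_left hw (by positivity)
    _ = ε / g / 6 * (A ^ (-(1 / c)) * (ε / g) ^ (1 / c)) := by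
        rw [Real.rpow_add (by positivity), Real.rpow_one]; ring
    _ ≤ ε / g / 6 * (1 / q) := mul_le_mul_of_nonneg_left hq' (by positivity)
    _ = ε / g / (6 * q) := by field_simp

/-- The quantitative removal bound for all densities. Using `log (2 / ε)` instead of `log (1 / ε)`
keeps the logarithm at least `1` up to `ε = 1`. -/
theorem exists_triangleCount_lower_bound (p : ℕ) [Fact p.Prime] :
    ∃ K : ℝ, 0 < K ∧
      ∀ (n m : ℕ) (x y z : Fin m → Fin n → ZMod p) (ε : ℝ),
        IsDisjointTriangleFamily x y z → 0 < ε → (m : ℝ) = ε * (p : ℝ) ^ n →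
          K * (ε ^ (1 + 1 / smallC p) *
              Real.logb 2 (2 / ε) ^ (-((2 + 2 * smallC p) / smallC p))) * ((p : ℝ) ^ n) ^ 2 ≤
            (triangleCount (univ.image x) (univ.image y) (univ.image z) : ℝ) := by
  have hp2 := (Fact.out : p.Prime).two_le
  have hp : (2 : ℝ) ≤ p := by exact_mod_cast hp2
  obtain ⟨K, hK, hKj⟩ := exists_lower_bound_of_scale (A := 1296 * (p : ℝ) ^ 2) (smallC_pos hp2)
    (smallC_le_one hp2) (by nlinarith)
  refine ⟨K, hK, fun n m x y z ε h hε hm => ?_⟩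
  obtain ⟨j, hj1, hj2⟩ := exists_scale h hε hm
  have hε1 : ε ≤ 1 := by
    have := card_le_of_isDisjointTriangleFamily h
    rw [hm] at this
    exact le_of_mul_le_mul_right (by rwa [one_mul]) (by positivity)
  exact (mul_le_mul_of_nonneg_right (hKj ε j hε hε1 hj1) (by positivity)).trans hj2

theorem sq_le_triangleCount_of_card_eq {p n m : ℕ} [Fact p.Prime] {x y z : Fin m → Fin n → ZMod p}
    (h : IsDisjointTriangleFamily x y z) (hm : m = p ^ n) :
    (p ^ n) ^ 2 ≤ triangleCount (univ.image x) (univ.image y) (univ.image z) := by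
  have hsurj : ∀ f : Fin m → Fin n → ZMod p, Function.Injective f → univ.image f = univ := by
    intro f hf
    refine eq_univ_of_card _ ?_
    rw [card_image_of_injective _ hf]
    simp [hm, ZMod.card]
  rw [hsurj x h.injective_fst, hsurj y h.injective_snd, hsurj z h.injective_trd]
  refine le_trans (le_of_eq ?_) (card_trianglePairs_le _ _ _)
  simp [trianglePairs, ZMod.card]
  ring

/-- The exponent error that turns the bound `K ε ^ C (log (2 / ε)) ^ (-e)` into a pure power. -/
noncomputable def exponentError (K e ε : ℝ) : ℝ :=
  Real.log (K * Real.logb 2 (2 / ε) ^ (-e)) / Real.log ε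

theorem tendsto_exponentError {K : ℝ} (hK : 0 < K) (e : ℝ) :
    Tendsto (exponentError K e) (𝓝[>] 0) (𝓝 0) := by
  have hL : Tendsto (fun ε : ℝ => Real.logb 2 (2 / ε)) (𝓝[>] 0) atTop :=
    (Real.tendsto_logb_atTop one_lt_two).comp
      (tendsto_inv_nhdsGT_zero.const_mul_atTop two_pos)
  have hnum : Tendsto (fun s : ℝ => (Real.log K - e * Real.log s) / s) atTop (𝓝 0) := by
    have h1 : Tendsto (fun s : ℝ => Real.log K / s) atTop (𝓝 0) :=
      tendsto_const_nhds.div_atTop tendsto_id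
    have h2 := Real.isLittleO_log_id_atTop.tendsto_div_nhds_zero.const_mul e
    refine ((h1.sub h2).congr fun s => ?_).trans_eq (by simp)
    simp only [id]
    ring
  have hden : Tendsto (fun s : ℝ => s / (1 - s)) atTop (𝓝 (-1)) := by
    have h1 : Tendsto (fun s : ℝ => (s⁻¹ - 1)⁻¹) atTop (𝓝 (-1)) := by
      have := (tendsto_inv_atTop_zero (𝕜 := ℝ)).sub_const 1
      simpa using this.inv₀ (by norm_num)
    refine h1.congr' ?_
    filter_upwards [eventually_gt_atTop 1] with s hs
    have h2 : 1 - s ≠ 0 := by linarith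
    have h3 : s⁻¹ - 1 = (1 - s) / s := by field_simp
    rw [h3, inv_div]
  have hlim := ((hnum.mul hden).div_const (Real.log 2)).comp hL
  rw [zero_mul, zero_div] at hlim
  refine hlim.congr' ?_
  filter_upwards [Ioo_mem_nhdsGT (zero_lt_one' ℝ)] with ε hε
  have hl2 : 0 < Real.log 2 := Real.log_pos one_lt_two
  set s := Real.logb 2 (2 / ε) with hs
  have hlog : Real.log ε = (1 - s) * Real.log 2 := by
    rw [hs, Real.logb, Real.log_div two_ne_zero hε.1.ne']
    field_simp
    ring
  have hs1 : 1 < s := by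
    have := Real.log_neg hε.1 hε.2
    nlinarith
  have h1 : 1 - s ≠ 0 := by linarith
  simp only [Function.comp, exponentError, ← hs]
  rw [Real.log_mul hK.ne' (by positivity), Real.log_rpow (by linarith), hlog]
  field_simp
  ring

theorem rpow_exponentError {K : ℝ} (hK : 0 < K) (e : ℝ) {ε : ℝ} (hε : 0 < ε) (hε1 : ε < 1) :
    ε ^ exponentError K e ε = K * Real.logb 2 (2 / ε) ^ (-e) := by
  have hL : 0 < Real.logb 2 (2 / ε) :=
    Real.logb_pos one_lt_two ((one_lt_div hε).mpr (by linarith))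
  rw [Real.rpow_def_of_pos hε, exponentError, mul_div_cancel₀ _ (Real.log_neg hε hε1).ne,
    Real.exp_log (by positivity)]

theorem theorem4 (p : ℕ) [Fact p.Prime] :
    (∃ h : ℝ → ℝ, Filter.Tendsto h (nhdsWithin 0 (Set.Ioi 0)) (nhds 0) ∧
      ∀ (n m : ℕ) (x y z : Fin m → Fin n → ZMod p) (ε : ℝ),
        IsDisjointTriangleFamily x y z → 0 < ε → (m : ℝ) = ε * (p : ℝ) ^ n →
          ε ^ (bigC p + h ε) * ((p : ℝ) ^ n) ^ 2 ≤
            (triangleCount (Finset.univ.image x) (Finset.univ.image y)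
              (Finset.univ.image z) : ℝ)) ∧
    (∃ K : ℝ, 0 < K ∧
      ∀ (n m : ℕ) (x y z : Fin m → Fin n → ZMod p) (ε : ℝ),
        IsDisjointTriangleFamily x y z → 0 < ε → ε ≤ 1 / 2 → (m : ℝ) = ε * (p : ℝ) ^ n →
          K * (ε ^ (1 + 1 / smallC p) *
              Real.logb 2 (1 / ε) ^ (-((2 + 2 * smallC p) / smallC p))) * ((p : ℝ) ^ n) ^ 2 ≤
            (triangleCount (Finset.univ.image x) (Finset.univ.image y)
              (Finset.univ.image z) : ℝ)) := by
  have hp2 := (Fact.out : p.Prime).two_le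
  have hc0 := smallC_pos hp2
  obtain ⟨K, hK, hbound⟩ := exists_triangleCount_lower_bound p
  set e := (2 + 2 * smallC p) / smallC p with he
  have he0 : 0 < e := by positivity
  refine ⟨⟨exponentError K e, tendsto_exponentError hK e, ?_⟩, K * 2 ^ (-e), by positivity, ?_⟩
  · intro n m x y z ε h hε hm
    have hp0 : (0 : ℝ) < (p : ℝ) ^ n := by
      have : (0 : ℝ) < p := by exact_mod_cast (Fact.out : p.Prime).pos
      positivity
    have hε1 : ε ≤ 1 := by
      have := card_le_of_isDisjointTriangleFamily h
      rw [hm] at this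
      exact le_of_mul_le_mul_right (by rwa [one_mul]) hp0
    rcases hε1.lt_or_eq with hlt | rfl
    · rw [Real.rpow_add hε, rpow_exponentError hK e hε hlt, bigC]
      refine le_trans (le_of_eq ?_) (hbound n m x y z ε h hε hm)
      ring
    -- At full density no power of `ε` can absorb the constant, but every pair spans a triangle.
    · rw [Real.one_rpow, one_mul]
      rw [one_mul] at hm
      exact_mod_cast sq_le_triangleCount_of_card_eq h (by exact_mod_cast hm)
  · intro n m x y z ε h hε hε2 hm
    refine le_trans (mul_le_mul_of_nonneg_right ?_ (by positivity)) (hbound n m x y z ε h hε hm)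
    have hl : 1 ≤ Real.logb 2 (1 / ε) := by
      rw [Real.le_logb_iff_rpow_le one_lt_two (by positivity), Real.rpow_one, le_div_iff₀ hε]
      linarith
    have hL : Real.logb 2 (2 / ε) = 1 + Real.logb 2 (1 / ε) := by
      rw [← mul_one_div, Real.logb_mul two_ne_zero (by positivity),
        Real.logb_self_eq_one one_lt_two]
    have h1 : (2 * Real.logb 2 (1 / ε)) ^ (-e) ≤ Real.logb 2 (2 / ε) ^ (-e) :=
      Real.rpow_le_rpow_of_nonpos (by linarith) (by linarith) (by linarith)
    rw [Real.mul_rpow two_pos.le (by linarith)] at h1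
    calc K * 2 ^ (-e) * (ε ^ (1 + 1 / smallC p) * Real.logb 2 (1 / ε) ^ (-e))
        = K * (ε ^ (1 + 1 / smallC p) * (2 ^ (-e) * Real.logb 2 (1 / ε) ^ (-e))) := by ring
      _ ≤ _ := by
        refine mul_le_mul_of_nonneg_left (mul_le_mul_of_nonneg_left h1 ?_) hK.le
        positivity
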